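/- **Setting.** Let $n_1,n_2,n_3\ge 2$ and $r\le\min\{n_1,n_2\}$ be integers, and write $n_1\vee n_2=\max\{n_1,n_2\}$. For third-order tensors $\mathcal X\in\mathbb R^{n_1\times n_2\times n_3}$ and $\mathcal Y\in\mathbb R^{n_2\times n_4\times n_3}$ with frontal slices $\mathbf X^{(k)}$, $\mathbf Y^{(k)}$, the tensor-tensor product $\mathcal X\diamond\mathcal Y\in\mathbb R^{n_1\times n_4\times n_3}$ is the tensor with frontal slices $\sum_{t=1}^{n_3}\mathbf X^{(k-t+1)}\mathbf Y^{(t)}$, superscripts being read modulo $n_3$ (that is, $\mathrm{Fold}(\mathrm{Circ}(\mathrm{Unfold}(\mathcal X))\cdot\mathrm{Unfold}(\mathcal Y))$). Let $\|\cdot\|_F$ be the Frobenius norm and $\|\cdot\|_0$ the number of nonzero entries. Let $\mathcal X^*=\mathcal A^*\diamond\mathcal B^*$ with $\mathcal A^*\in\mathbb R^{n_1\times r\times n_3}$, $\mathcal B^*\in\mathbb R^{r\times n_2\times n_3}$, $0\le\mathcal A^*_{ijk}\le 1$, $0\le\mathcal B^*_{ijk}\le b$ and $\mathcal X^*_{ijk}\le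 c/2$ for all indices, and let $\zeta>0$ be such that $\mathcal X^*_{ijk}\ge\zeta$ for all $i,j,k$ (for instance $\zeta=\min_{i,j,k}\mathcal X^*_{ijk}$, if this is positive). Put $$\beta=\max\Big\{3,\,1+\frac{\log(3rn_3^{1.5}b/c)}{\log(n_1\vee n_2)}\Big\},\quad \vartheta=2^{\lceil\beta\log_2(n_1\vee n_2)\rceil},\quad \kappa=\frac{c^2}{\zeta},\quad \lambda=4(\beta+2)\Big(1+\frac{2\kappa}{3}\Big)\log(n_1\vee n_2).$$ Let $\mathfrak L$ be the set of tensors $\mathcal A\in\mathbb R^{n_1\times r\times n_3}$ all of whose entries lie in the set $\{k/(\vartheta-1):k=0,\dots,\vartheta-1\}$ of $\vartheta$ equally spaced levels of $[0,1]$, let $\mathfrak D$ be the set of tensors $\mathcal B\in\mathbb R^{r\times n_2\times n_3}$ each of whose entries is $0$ or lies in $\{bk/(\vartheta-1):k=0,\dots,\vartheta-1\}$, and let the set of candidates be $$\Gamma=\{\mathcal X=\mathcal A\diamond\mathcal B:\ \mathcal A\in\mathfrak L,\ \mathcal B\in\mathfrak D,\ 0\le\mathcal X_{ijk}\le c\ \text{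 and }\ \mathcal X_{ijk}\ge\zeta\ \text{ for all } i,j,k\}.$$ **Observations.** Let $m$ be an integer with $4\le m\le n_1n_2n_3$. Each index $(i,j,k)$ belongs to the random set $\Omega$ independently with probability $\gamma=\frac{m}{n_1n_2n_3}$. The entries $\mathcal Y_{ijk}$ are independent of each other and of $\Omega$, $\mathcal Y_{ijk}$ has the Poisson distribution with parameter $\mathcal X^*_{ijk}$, and $\mathcal Y_{ijk}$ is observed for $(i,j,k)\in\Omega$. Let $$p_{\mathcal X_\Omega}(\mathcal Y_\Omega)=\prod_{(i,j,k)\in\Omega}\frac{\mathcal X_{ijk}^{\mathcal Y_{ijk}}e^{-\mathcal X_{ijk}}}{\mathcal Y_{ijk}!},$$ and let the (measurable) estimator $\widetilde{\mathcal X}^\lambda$ satisfy $$\widetilde{\mathcal X}^\lambda\in\arg\min_{\mathcal X=\mathcal A\diamond\mathcal B\in\Gamma}\big\{-\log p_{\mathcal X_\Omega}(\mathcal Y_\Omega)+\lambda\|\mathcal B\|_0\big\},$$ the minimum being over the pairs $(\mathcal A,\mathcal B)$ that define elements of $\Gamma$, with ties broken arbitrarily. **Claim.** The expected squared error is finite and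 $$\frac{\mathbb E_{\Omega,\mathcal Y_\Omega}\|\widetilde{\mathcal X}^\lambda-\mathcal X^*\|_F^2}{n_1n_2n_3}\le\frac{4c^3(3+8\log m)}{\zeta m}+48c\Big(1+\frac{4c^2}{3\zeta}\Big)\frac{(\beta+2)\,(rn_1n_3+\|\mathcal B^*\|_0)\,\log(n_1\vee n_2)}{m}.$$ -/

import Mathlib

open MeasureTheory ProbabilityTheory
open scoped Nat

noncomputable section

namespace SparseNTF

/-- The index set of third-order `n₁ × n₂ × n₃` tensors. -/
abbrev Idx (n₁ n₂ n₃ : ℕ) : Type := Fin n₁ × Fin n₂ × Fin n₃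

/-- Real third-order `n₁ × n₂ × n₃` tensors; the third index numbers the frontal slices. -/
abbrev Tensor (n₁ n₂ n₃ : ℕ) : Type := Idx n₁ n₂ n₃ → ℝ

section TensorAlgebra

variable {n₁ n₂ n₃ n₄ : ℕ}

/-- The `k`-th frontal slice. -/
def slice (X : Tensor n₁ n₂ n₃) (k : Fin n₃) : Matrix (Fin n₁) (Fin n₂) ℝ :=
  Matrix.of fun i j => X (i, j, k)

/-- `Unfold`: the frontal slices stacked on top of each other; the row index is
(number of the block, row in the block). -/
def unfold (X : Tensor n₁ n₂ n₃) : Matrix (Fin n₃ × Fin n₁) (Fin n₂) ℝ :=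
  Matrix.of fun p j => slice X p.1 p.2 j

/-- `Fold`, the inverse of `unfold`. -/
def fold (M : Matrix (Fin n₃ × Fin n₁) (Fin n₂) ℝ) : Tensor n₁ n₂ n₃ :=
  fun p => M (p.2.2, p.1) p.2.1

/-- `Circ`: the block circulant matrix with a given first block column. The block in position
`(k, t)` is block number `k - t` (modulo `n₃`, blocks being numbered from `0`). -/
def circ (M : Matrix (Fin n₃ × Fin n₁) (Fin n₂) ℝ) :
    Matrix (Fin n₃ × Fin n₁) (Fin n₃ × Fin n₂) ℝ :=
  Matrix.of fun p q => M (p.1 - q.1, p.2) q.2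

/-- The tensor-tensor product. -/
def tprod (X : Tensor n₁ n₂ n₃) (Y : Tensor n₂ n₄ n₃) : Tensor n₁ n₄ n₃ :=
  fold (circ (unfold X) * unfold Y)

/-- The tensor `ℓ₀` norm: the number of nonzero entries. -/
def l0norm (X : Tensor n₁ n₂ n₃) : ℕ := (Finset.univ.filter fun p => X p ≠ 0).card

/-- The tensor Frobenius norm. -/
def frobNorm (X : Tensor n₁ n₂ n₃) : ℝ := √(∑ p, X p ^ 2)

end TensorAlgebra

/-- `β = max {3, 1 + log (3 r n₃^{1.5} b / c) / log (n₁ ∨ n₂)}`. -/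
def betaParam (n₁ n₂ n₃ r : ℕ) (b c : ℝ) : ℝ :=
  max 3 (1 + Real.log (3 * r * (n₃ : ℝ) ^ (3 / 2 : ℝ) * b / c) / Real.log (max n₁ n₂ : ℕ))

/-- `λ = 4 (β + 2) (1 + 2 κ / 3) log (n₁ ∨ n₂)`. -/
def lambdaParam (n₁ n₂ : ℕ) (β κ : ℝ) : ℝ :=
  4 * (β + 2) * (1 + 2 * κ / 3) * Real.log (max n₁ n₂ : ℕ)

/-- The number of quantization levels, `ϑ = 2 ^ ⌈β log₂ (n₁ ∨ n₂)⌉`. -/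
def levels (n₁ n₂ : ℕ) (β : ℝ) : ℕ := 2 ^ ⌈β * Real.logb 2 (max n₁ n₂ : ℕ)⌉₊

/-- The `ϑ` equally spaced levels `0, a / (ϑ - 1), 2 a / (ϑ - 1), …, a` of the range `[0, a]`. -/
def grid (ϑ : ℕ) (a : ℝ) : Set ℝ := {x | ∃ k : ℕ, k < ϑ ∧ x = a * (k / ((ϑ : ℝ) - 1))}

/-- The discretized first factors. -/
def codebookA (n₁ r n₃ ϑ : ℕ) : Set (Tensor n₁ r n₃) := {A | ∀ p, A p ∈ grid ϑ 1}

/-- The discretized second factors; an entry is `0` or one of the levels of `[0, b]`. -/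
def codebookB (r n₂ n₃ ϑ : ℕ) (b : ℝ) : Set (Tensor r n₂ n₃) :=
  {B | ∀ p, B p = 0 ∨ B p ∈ grid ϑ b}

/-- The pairs `(A, B)` of discretized factors that define a candidate `X = A ⋄ B` with
`0 ≤ X ≤ c`, all of whose entries are at least `ζ`. -/
def candidates (n₁ n₂ n₃ r ϑ : ℕ) (b c ζ : ℝ) : Set (Tensor n₁ r n₃ × Tensor r n₂ n₃) :=
  {q | q.1 ∈ codebookA n₁ r n₃ ϑ ∧ q.2 ∈ codebookB r n₂ n₃ ϑ b ∧
    (∀ p, 0 ≤ tprod q.1 q.2 p ∧ tprod q.1 q.2 p ≤ c) ∧ ∀ p, ζ ≤ tprod q.1 q.2 p}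

open Classical in
/-- The Poisson likelihood `∏_{p ∈ Ω} X_p ^ Y_p * exp (-X_p) / Y_p !` of the observed entries. -/
def likelihood {n₁ n₂ n₃ : ℕ} (X : Tensor n₁ n₂ n₃) (Ω : Set (Idx n₁ n₂ n₃))
    (Y : Idx n₁ n₂ n₃ → ℕ) : ℝ :=
  ∏ p with p ∈ Ω, X p ^ Y p * Real.exp (-X p) / (Y p)!

/-- The objective `-log p_{X_Ω}(Y_Ω) + λ ‖B‖₀` at `X = A ⋄ B`. -/
def objective {n₁ n₂ n₃ r : ℕ} (lam : ℝ) (Ω : Set (Idx n₁ n₂ n₃)) (Y : Idx n₁ n₂ n₃ → ℕ)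
    (q : Tensor n₁ r n₃ × Tensor r n₂ n₃) : ℝ :=
  -Real.log (likelihood (tprod q.1 q.2) Ω Y) + lam * l0norm q.2

/-- `X` is an estimate for the data `(Ω, Y_Ω)`: `X = A ⋄ B` where the pair `(A, B)` minimizes the
objective over all pairs in `C`. -/
def IsEstimate {n₁ n₂ n₃ r : ℕ} (C : Set (Tensor n₁ r n₃ × Tensor r n₂ n₃)) (lam : ℝ)
    (Ω : Set (Idx n₁ n₂ n₃)) (Y : Idx n₁ n₂ n₃ → ℕ) (X : Tensor n₁ n₂ n₃) : Prop :=
  ∃ q ∈ C, X = tprod q.1 q.2 ∧ IsMinOn (objective lam Ω Y) C q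

end SparseNTF

end

/-! Let ℓ_q be the sampled log-likelihood ratio of candidate q against the truth, let h = (√x - √μ)²
entrywise, and write λ = ξτ with ξ = 2 + 4κ/3. Since ξ⁻¹ ≤ 1/2, convexity of exp gives E exp(ξ⁻¹
logRatio) ≤ exp(-h/ξ) for one Poisson entry (`integral_exp_mul_logRatio_le`). Averaging over the
Bernoulli sample gives E exp(ξ⁻¹ ℓ_q) ≤ exp(-G_q), where G_q = γ ∑ (1 - exp(-h/ξ)).

The penalties L_q = τ(r n₁ n₃ + ‖B‖₀) satisfy Kraft's inequality (`kraft_levels`), so Z = ∑_q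
exp(ξ⁻¹ ℓ_q + G_q - L_q) has mean at most 1. Each exponent is at most Z - 1, so ξ G_q ≤ -ℓ_q + ξ L_q
+ ξ(Z - 1) holds for all q at once, in particular for the data-dependent minimizer. Minimality
replaces q by a fixed q₀ on the right, and taking means bounds the risk by that of q₀
(`penalized_likelihood_bound`).

Two deterministic facts finish the proof: (x - μ)² is at most 11c/2 times ξ(1 - exp(-h/ξ))
(`sq_sub_le_of_le`), and rounding the true factors up to the grids yields a q₀ whose divergence from
the truth is at most κ in total (`exists_candidate`). No concentration inequality enters, so the log
m term of the claim is pure slack. -/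

namespace SparseNTF

/-! ### Moments of Poisson log-likelihood ratios -/

section Poisson

open NNReal

lemma hasSum_exp_mul_poisson (μ : ℝ≥0) (u : ℝ) :
    HasSum (fun n : ℕ => Real.exp (-μ) * μ ^ n / n ! * Real.exp (u * n))
      (Real.exp (μ * (Real.exp u - 1))) := by
  have h := (NormedSpace.expSeries_div_hasSum_exp ((μ : ℝ) * Real.exp u)).mul_left (Real.exp (-μ))
  rw [← Real.exp_eq_exp_ℝ, ← Real.exp_add] at h
  rw [show (μ : ℝ) * (Real.exp u - 1) = -μ + μ * Real.exp u by ring]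
  convert! h using 1
  ext n
  rw [mul_pow, ← Real.exp_nat_mul, mul_comm u]
  ring

lemma integrable_exp_mul_poissonMeasure (μ : ℝ≥0) (u : ℝ) :
    Integrable (fun n : ℕ => Real.exp (u * n)) (poissonMeasure μ) := by
  rw [integrable_poissonMeasure_iff]
  simpa using (hasSum_exp_mul_poisson μ u).summable

lemma integral_exp_mul_poissonMeasure (μ : ℝ≥0) (u : ℝ) :
    ∫ n : ℕ, Real.exp (u * n) ∂(poissonMeasure μ) = Real.exp (μ * (Real.exp u - 1)) := by
  rw [integral_poissonMeasure]
  simpa using (hasSum_exp_mul_poisson μ u).tsum_eq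

lemma hasSum_id_mul_poisson (μ : ℝ≥0) :
    HasSum (fun n : ℕ => Real.exp (-μ) * μ ^ n / n ! * (n : ℝ)) μ := by
  rw [← hasSum_nat_add_iff' 1]
  have h := (hasSum_one_poissonMeasure μ).mul_left (μ : ℝ)
  simp only [Finset.range_one, Finset.sum_singleton, Nat.cast_zero, mul_zero, sub_zero]
  rw [mul_one] at h
  convert! h using 1
  ext n
  have h1 : ((n : ℝ) + 1) ≠ 0 := by positivity
  have h2 : ((n ! : ℕ) : ℝ) ≠ 0 := by positivity
  rw [Nat.factorial_succ]
  push_cast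
  field_simp
  ring

lemma integrable_natCast_poissonMeasure (μ : ℝ≥0) :
    Integrable (fun n : ℕ => (n : ℝ)) (poissonMeasure μ) := by
  rw [integrable_poissonMeasure_iff]
  simpa using (hasSum_id_mul_poisson μ).summable

lemma integral_natCast_poissonMeasure (μ : ℝ≥0) :
    ∫ n : ℕ, (n : ℝ) ∂(poissonMeasure μ) = μ := by
  rw [integral_poissonMeasure]
  simpa using (hasSum_id_mul_poisson μ).tsum_eq

/-- The logarithm of the likelihood ratio of the Poisson laws with rates `x` and `μ`. -/
noncomputable def logRatio (μ x : ℝ) (n : ℕ) : ℝ := n * Real.log (x / μ) - (x - μ)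

lemma integrable_logRatio (ν : ℝ≥0) (μ x : ℝ) :
    Integrable (logRatio μ x) (poissonMeasure ν) :=
  ((integrable_natCast_poissonMeasure ν).mul_const _).sub (integrable_const _)

/-- The left side is the Kullback–Leibler divergence of the two Poisson laws; log t ≤ t - 1 at t =
μ/x bounds it by a χ²-type quantity. -/
lemma integral_neg_logRatio_le {μ x : ℝ} (hμ : 0 < μ) (hx : 0 < x) :
    ∫ n, -logRatio μ x n ∂(poissonMeasure μ.toNNReal) ≤ (x - μ) ^ 2 / x := by
  unfold logRatio
  rw [integral_neg, integral_sub ((integrable_natCast_poissonMeasure _).mul_const _)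
    (integrable_const _), integral_mul_const, integral_natCast_poissonMeasure]
  simp only [integral_const, probReal_univ, one_smul, Real.coe_toNNReal _ hμ.le]
  have h1 : Real.log (μ / x) ≤ μ / x - 1 := Real.log_le_sub_one_of_pos (by positivity)
  have h2 : Real.log (x / μ) = -Real.log (μ / x) := by rw [← Real.log_inv, inv_div]
  rw [h2]
  have h3 := mul_le_mul_of_nonneg_left h1 hμ.le
  have h4 : (x - μ) ^ 2 / x = μ * (μ / x - 1) + x - μ := by field_simp; ring
  rw [h4]
  linarith

lemma exp_mul_logRatio (s μ x : ℝ) (n : ℕ) :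
    Real.exp (s * logRatio μ x n) =
      Real.exp (-(s * (x - μ))) * Real.exp (s * Real.log (x / μ) * n) := by
  rw [← Real.exp_add, logRatio]
  ring_nf

lemma integrable_exp_mul_logRatio (ν : ℝ≥0) (s μ x : ℝ) :
    Integrable (fun n => Real.exp (s * logRatio μ x n)) (poissonMeasure ν) := by
  simp_rw [exp_mul_logRatio]
  exact (integrable_exp_mul_poissonMeasure _ _).const_mul _

lemma integral_exp_mul_logRatio_le {s μ x : ℝ} (hs : 0 ≤ s) (hs' : s ≤ 1 / 2) (hμ : 0 < μ)
    (hx : 0 < x) :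
    ∫ n, Real.exp (s * logRatio μ x n) ∂(poissonMeasure μ.toNNReal) ≤
      Real.exp (-(s * (√x - √μ) ^ 2)) := by
  simp_rw [exp_mul_logRatio]
  rw [integral_const_mul, integral_exp_mul_poissonMeasure, ← Real.exp_add,
    Real.coe_toNNReal _ hμ.le, Real.exp_le_exp]
  -- The chord of exp between 0 and log(x/μ)/2 gives (x/μ)^s ≤ 1 - 2s + 2s √(x/μ); this is where s ≤
  -- 1/2 matters.
  have hconv := convexOn_exp.2 (Set.mem_univ (0 : ℝ)) (Set.mem_univ (Real.log (x / μ) / 2))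
    (by linarith : 0 ≤ 1 - 2 * s) (by linarith : 0 ≤ 2 * s) (by ring)
  have e1 : (1 - 2 * s) • (0 : ℝ) + (2 * s) • (Real.log (x / μ) / 2) = s * Real.log (x / μ) := by
    simp only [smul_eq_mul]; ring
  have e2 : Real.exp (Real.log (x / μ) / 2) = √x / √μ := by
    rw [← Real.log_sqrt (by positivity), Real.exp_log (by positivity), Real.sqrt_div hx.le]
  rw [e1, e2, Real.exp_zero] at hconv
  simp only [smul_eq_mul, mul_one] at hconv
  have h1 := mul_le_mul_of_nonneg_left hconv hμ.le
  have hm : √μ ^ 2 = μ := Real.sq_sqrt hμ.le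
  have hxx : √x ^ 2 = x := Real.sq_sqrt hx.le
  have hp : 0 < √μ := Real.sqrt_pos.2 hμ
  have h2 : μ * (√x / √μ) = √x * √μ := by
    rw [← hm]; field_simp; simp [hp.le]
  have h3 : μ * (1 - 2 * s + 2 * s * (√x / √μ)) = μ - 2 * s * μ + 2 * s * (√x * √μ) := by
    rw [← h2]; ring
  rw [h3] at h1
  have h4 : s * (√x - √μ) ^ 2 = s * x - 2 * s * (√x * √μ) + s * μ := by
    linear_combination s * hxx + s * hm
  rw [h4]
  linarith

end Poisson

/-! ### Integration over a Bernoulli sample and independent counts -/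

section Sampling

variable {ι : Type*} [Fintype ι]

open Classical in
lemma integral_prod_ite_setBernoulli (γ : unitInterval) (a : ι → ℝ) :
    ∫ T, ∏ i, (if i ∈ T then a i else 1) ∂(setBernoulli (Set.univ : Set ι) γ) =
      ∏ i, (1 - (γ : ℝ) + γ * a i) := by
  rw [setBernoulli_eq_map, Measure.infinitePi_eq_pi,
    integral_map Measurable.of_discrete.aemeasurable Measurable.of_discrete.aestronglyMeasurable]
  simp only [Set.mem_ofPred_eq]
  rw [integral_fintype_prod_eq_prod (fun i (p : Prop) => if p then a i else (1 : ℝ))]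
  refine Finset.prod_congr rfl fun i _ => ?_
  rw [integral_add_measure .of_finite .of_finite, integral_smul_nnreal_measure,
    integral_smul_nnreal_measure, integral_dirac, integral_dirac]
  simp [NNReal.smul_def]
  ring

open Classical in
lemma integral_ite_setBernoulli (γ : unitInterval) (i : ι) :
    ∫ T, (if i ∈ T then (1 : ℝ) else 0) ∂(setBernoulli (Set.univ : Set ι) γ) = γ := by
  -- With weight 0 at `i` and 1 elsewhere, the product is one minus the indicator of `i ∈ T`.
  have h := integral_prod_ite_setBernoulli γ (fun j : ι => if j = i then (0 : ℝ) else 1)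
  have h1 : ∀ T : Set ι, ∏ j, (if j ∈ T then (if j = i then (0 : ℝ) else 1) else 1) =
      1 - if i ∈ T then (1 : ℝ) else 0 := by
    intro T
    rw [Finset.prod_eq_single i (by intro j _ hj; simp [hj]) (by simp)]
    split_ifs <;> simp_all
  simp_rw [h1] at h
  rw [Finset.prod_eq_single i (by intro j _ hj; simp [hj]) (by simp),
    integral_sub (integrable_const _) .of_finite] at h
  simp at h
  simpa using h

variable (γ : unitInterval) (ν : ι → Measure ℕ) [∀ i, IsProbabilityMeasure (ν i)]

open Classical in
lemma integrable_prod_ite {f : ι → ℕ → ℝ} (hf : ∀ i, Integrable (f i) (ν i)) :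
    Integrable (fun z : Set ι × (ι → ℕ) => ∏ i, if i ∈ z.1 then f i (z.2 i) else 1)
      ((setBernoulli (Set.univ : Set ι) γ).prod (Measure.pi ν)) := by
  -- A dominating product that no longer depends on the sampled set.
  have h1 : Integrable (fun y : ι → ℕ => ∏ i, (1 + |f i (y i)|)) (Measure.pi ν) :=
    Integrable.fintype_prod fun i => (integrable_const _).add (hf i).abs
  refine (h1.comp_snd _).mono' Measurable.of_discrete.aestronglyMeasurable
    (.of_forall fun z => ?_)
  rw [Real.norm_eq_abs, Finset.abs_prod]
  refine Finset.prod_le_prod (fun i _ => abs_nonneg _) fun i _ => ?_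
  split_ifs
  · linarith
  · simp

open Classical in
lemma integral_prod_ite {f : ι → ℕ → ℝ} (hf : ∀ i, Integrable (f i) (ν i)) :
    ∫ z : Set ι × (ι → ℕ), ∏ i, (if i ∈ z.1 then f i (z.2 i) else 1)
      ∂((setBernoulli (Set.univ : Set ι) γ).prod (Measure.pi ν)) =
      ∏ i, (1 - (γ : ℝ) + γ * ∫ n, f i n ∂(ν i)) := by
  rw [integral_prod _ (integrable_prod_ite γ ν hf), ← integral_prod_ite_setBernoulli]
  congr 1 with T
  have h := integral_fintype_prod_eq_prod (μ := ν)
    (fun i (n : ℕ) => if i ∈ T then f i n else (1 : ℝ))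
  simp only at h ⊢
  rw [h]
  refine Finset.prod_congr rfl fun i _ => ?_
  split_ifs <;> simp

open Classical in
lemma integrable_sum_ite {f : ι → ℕ → ℝ} (hf : ∀ i, Integrable (f i) (ν i)) :
    Integrable (fun z : Set ι × (ι → ℕ) => ∑ i, if i ∈ z.1 then f i (z.2 i) else 0)
      ((setBernoulli (Set.univ : Set ι) γ).prod (Measure.pi ν)) ∧
    ∫ z : Set ι × (ι → ℕ), ∑ i, (if i ∈ z.1 then f i (z.2 i) else 0)
      ∂((setBernoulli (Set.univ : Set ι) γ).prod (Measure.pi ν)) =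
      γ * ∑ i, ∫ n, f i n ∂(ν i) := by
  have e : ∀ i (z : Set ι × (ι → ℕ)), (if i ∈ z.1 then f i (z.2 i) else 0) =
      (if i ∈ z.1 then (1 : ℝ) else 0) * f i (z.2 i) := by
    intro i z; split_ifs <;> simp
  simp_rw [e]
  have h1 : ∀ i, Integrable (fun z : Set ι × (ι → ℕ) =>
      (if i ∈ z.1 then (1 : ℝ) else 0) * f i (z.2 i))
      ((setBernoulli (Set.univ : Set ι) γ).prod (Measure.pi ν)) := fun i =>
    Integrable.mul_prod (f := fun T : Set ι => if i ∈ T then (1 : ℝ) else 0)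
      (g := fun y : ι → ℕ => f i (y i)) .of_finite (integrable_comp_eval (hf i))
  refine ⟨integrable_finsetSum _ fun i _ => h1 i, ?_⟩
  rw [integral_finsetSum _ fun i _ => h1 i, Finset.mul_sum]
  refine Finset.sum_congr rfl fun i _ => ?_
  rw [integral_prod_mul (fun T : Set ι => if i ∈ T then (1 : ℝ) else 0)
    (fun y : ι → ℕ => f i (y i)), integral_ite_setBernoulli,
    integral_comp_eval (hf i).aestronglyMeasurable]

end Sampling

/-! ### The oracle inequality and its conversion to squared error -/

section PenalizedLikelihood

variable {ι α : Type*} [Fintype ι]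

open Classical in
/-- The logarithm of the likelihood ratio of the rates `x` and `μ`, for the observations `z.2` on
the index set `z.1`. -/
noncomputable def sampledLogRatio (μ x : ι → ℝ) (z : Set ι × (ι → ℕ)) : ℝ :=
  ∑ i, if i ∈ z.1 then logRatio (μ i) (x i) (z.2 i) else 0

open Classical in
lemma exp_mul_sampledLogRatio (s : ℝ) (μ x : ι → ℝ) (z : Set ι × (ι → ℕ)) :
    Real.exp (s * sampledLogRatio μ x z) =
      ∏ i, if i ∈ z.1 then Real.exp (s * logRatio (μ i) (x i) (z.2 i)) else 1 := by
  rw [sampledLogRatio, Finset.mul_sum, Real.exp_sum]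
  refine Finset.prod_congr rfl fun i _ => ?_
  split_ifs <;> simp

/-- The law of a Bernoulli sample of the index set together with independent Poisson counts. -/
noncomputable def samplingLaw (γ : unitInterval) (μ : ι → ℝ) : Measure (Set ι × (ι → ℕ)) :=
  (setBernoulli (Set.univ : Set ι) γ).prod (Measure.pi fun i => poissonMeasure (μ i).toNNReal)

instance (γ : unitInterval) (μ : ι → ℝ) : IsProbabilityMeasure (samplingLaw γ μ) := by
  unfold samplingLaw
  infer_instance

lemma integrable_exp_mul_sampledLogRatio (γ : unitInterval) (s : ℝ) (μ x : ι → ℝ) :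
    Integrable (fun z => Real.exp (s * sampledLogRatio μ x z)) (samplingLaw γ μ) := by
  simp_rw [exp_mul_sampledLogRatio]
  exact integrable_prod_ite γ _ (f := fun i n => Real.exp (s * logRatio (μ i) (x i) n))
    fun i => integrable_exp_mul_logRatio _ _ _ _

/-- An entry is missed with probability 1 - γ and then contributes the factor 1; use 1 - γ + γ
e^(-v) ≤ exp(-γ(1 - e^(-v))). -/
lemma integral_exp_mul_sampledLogRatio_le (γ : unitInterval) {s : ℝ} (hs : 0 ≤ s)
    (hs' : s ≤ 1 / 2) {μ x : ι → ℝ} (hμ : ∀ i, 0 < μ i) (hx : ∀ i, 0 < x i) :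
    ∫ z, Real.exp (s * sampledLogRatio μ x z) ∂(samplingLaw γ μ) ≤
      Real.exp (-(γ * ∑ i, (1 - Real.exp (-(s * (√(x i) - √(μ i)) ^ 2))))) := by
  simp_rw [exp_mul_sampledLogRatio]
  have h := integral_prod_ite γ (fun i => poissonMeasure (μ i).toNNReal)
    (f := fun i n => Real.exp (s * logRatio (μ i) (x i) n))
    fun i => integrable_exp_mul_logRatio _ _ _ _
  rw [samplingLaw]
  rw [h, Finset.mul_sum, ← Finset.sum_neg_distrib, Real.exp_sum]
  have hγ0 : (0 : ℝ) ≤ γ := γ.2.1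
  have hγ1 : (γ : ℝ) ≤ 1 := γ.2.2
  refine Finset.prod_le_prod (fun i _ => ?_) fun i _ => ?_
  · have : 0 ≤ ∫ n, Real.exp (s * logRatio (μ i) (x i) n) ∂(poissonMeasure (μ i).toNNReal) :=
      integral_nonneg fun n => (Real.exp_pos _).le
    have := mul_nonneg hγ0 this
    linarith
  · have h1 := mul_le_mul_of_nonneg_left
      (integral_exp_mul_logRatio_le hs hs' (hμ i) (hx i)) hγ0
    have h2 := Real.add_one_le_exp
      (-((γ : ℝ) * (1 - Real.exp (-(s * (√(x i) - √(μ i)) ^ 2)))))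
    linarith

lemma integrable_sampledLogRatio (γ : unitInterval) (μ x : ι → ℝ) :
    Integrable (sampledLogRatio μ x) (samplingLaw γ μ) := by
  unfold sampledLogRatio samplingLaw
  exact (integrable_sum_ite γ _ (f := fun i n => logRatio (μ i) (x i) n)
    fun i => integrable_logRatio _ _ _).1

lemma integral_neg_sampledLogRatio_le (γ : unitInterval) {μ x : ι → ℝ} (hμ : ∀ i, 0 < μ i)
    (hx : ∀ i, 0 < x i) :
    ∫ z, -sampledLogRatio μ x z ∂(samplingLaw γ μ) ≤ γ * ∑ i, (x i - μ i) ^ 2 / x i := by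
  have h := (integrable_sum_ite γ (fun i => poissonMeasure (μ i).toNNReal)
    (f := fun i n => logRatio (μ i) (x i) n) fun i => integrable_logRatio _ _ _).2
  unfold sampledLogRatio samplingLaw
  rw [integral_neg, h, ← mul_neg, ← Finset.sum_neg_distrib]
  refine mul_le_mul_of_nonneg_left (Finset.sum_le_sum fun i _ => ?_) γ.2.1
  rw [← integral_neg]
  exact integral_neg_logRatio_le (hμ i) (hx i)

/-- An oracle inequality for minimizers of a penalized Poisson likelihood over a finite set of
candidates whose penalties satisfy Kraft's inequality. -/
theorem penalized_likelihood_bound (γ : unitInterval) {ξ : ℝ} (hξ : 2 ≤ ξ) {μ : ι → ℝ}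
    (hμ : ∀ i, 0 < μ i) (K : Finset α) (X : α → ι → ℝ) (hX : ∀ q ∈ K, ∀ i, 0 < X q i)
    (L : α → ℝ) (hL : ∑ q ∈ K, Real.exp (-L q) ≤ 1) {q₀ : α} (hq₀ : q₀ ∈ K) :
    ∃ R : Set ι × (ι → ℕ) → ℝ, Integrable R (samplingLaw γ μ) ∧
      ∫ z, R z ∂(samplingLaw γ μ) ≤ γ * ∑ i, (X q₀ i - μ i) ^ 2 / X q₀ i + ξ * L q₀ ∧
      ∀ z, ∀ q ∈ K, -sampledLogRatio μ (X q) z + ξ * L q ≤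
          -sampledLogRatio μ (X q₀) z + ξ * L q₀ →
        γ * ∑ i, ξ * (1 - Real.exp (-(ξ⁻¹ * (√(X q i) - √(μ i)) ^ 2))) ≤ R z := by
  have hξ0 : 0 < ξ := by linarith
  have hs : 0 ≤ ξ⁻¹ := by positivity
  have hs' : ξ⁻¹ ≤ 1 / 2 := by
    rw [one_div]
    exact inv_anti₀ (by norm_num) hξ
  let G : α → ℝ := fun q => γ * ∑ i, (1 - Real.exp (-(ξ⁻¹ * (√(X q i) - √(μ i)) ^ 2)))
  -- `G q` offsets the bound on the exponential moment, so each summand has mean at most exp(-`L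
  -- q`).
  let Z : Set ι × (ι → ℕ) → ℝ := fun z =>
    ∑ q ∈ K, Real.exp (ξ⁻¹ * sampledLogRatio μ (X q) z) * Real.exp (G q - L q)
  have hZi : ∀ q ∈ K, Integrable (fun z => Real.exp (ξ⁻¹ * sampledLogRatio μ (X q) z) *
      Real.exp (G q - L q)) (samplingLaw γ μ) := fun q _ =>
    (integrable_exp_mul_sampledLogRatio γ _ _ _).mul_const _
  have hZ : Integrable Z (samplingLaw γ μ) := integrable_finsetSum _ hZi
  have hZ1 : ∫ z, Z z ∂(samplingLaw γ μ) ≤ 1 := by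
    refine le_trans ?_ hL
    rw [integral_finsetSum _ hZi]
    refine Finset.sum_le_sum fun q hq => ?_
    rw [integral_mul_const]
    calc _ ≤ Real.exp (-G q) * Real.exp (G q - L q) :=
          mul_le_mul_of_nonneg_right
            (integral_exp_mul_sampledLogRatio_le γ hs hs' hμ (hX q hq)) (Real.exp_pos _).le
      _ = _ := by rw [← Real.exp_add]; ring_nf
  have hI := (integrable_sampledLogRatio γ μ (X q₀)).neg
  have hI' : Integrable (fun z => ξ * (Z z - 1)) (samplingLaw γ μ) :=
    (hZ.sub (integrable_const _)).const_mul _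
  refine ⟨fun z => ξ * (Z z - 1) + (-sampledLogRatio μ (X q₀) z) + ξ * L q₀,
    (hI'.add hI).add (integrable_const _), ?_, fun z q hq hmin => ?_⟩
  · have e1 := integral_add (hI'.add hI) (integrable_const (ξ * L q₀))
    have e2 := integral_add hI' hI
    have e3 := integral_sub hZ (integrable_const (μ := samplingLaw γ μ) (1 : ℝ))
    simp only [Pi.add_apply, Pi.neg_apply, integral_const, probReal_univ, smul_eq_mul,
      one_mul, integral_const_mul] at e1 e2 e3
    rw [e1, e2, e3]
    have h1 := integral_neg_sampledLogRatio_le γ hμ (hX q₀ hq₀)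
    have h2 : ξ * (∫ z, Z z ∂(samplingLaw γ μ) - 1) ≤ 0 :=
      mul_nonpos_of_nonneg_of_nonpos hξ0.le (by linarith)
    linarith
  -- One summand is at most the whole sum, whichever `q` the data select; this replaces a union
  -- bound.
  · have h1 : Real.exp (ξ⁻¹ * sampledLogRatio μ (X q) z) * Real.exp (G q - L q) ≤ Z z :=
      Finset.single_le_sum (f := fun q => Real.exp (ξ⁻¹ * sampledLogRatio μ (X q) z) *
        Real.exp (G q - L q)) (fun q _ => by positivity) hq
    rw [← Real.exp_add] at h1
    have h2 := Real.add_one_le_exp (ξ⁻¹ * sampledLogRatio μ (X q) z + (G q - L q))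
    have h3 : ξ * (ξ⁻¹ * sampledLogRatio μ (X q) z + (G q - L q)) ≤ ξ * (Z z - 1) :=
      mul_le_mul_of_nonneg_left (by linarith) hξ0.le
    have h4 : ξ * (ξ⁻¹ * sampledLogRatio μ (X q) z + (G q - L q)) =
        sampledLogRatio μ (X q) z + ξ * G q - ξ * L q := by
      field_simp
      ring
    have h5 : γ * ∑ i, ξ * (1 - Real.exp (-(ξ⁻¹ * (√(X q i) - √(μ i)) ^ 2))) = ξ * G q := by
      simp only [G]
      rw [← Finset.mul_sum]
      ring
    rw [h5]
    linarith

/-- (x - μ)² = (√x + √μ)² h ≤ 4ch, and h/ξ ≤ 3/8 keeps 1 - exp(-h/ξ) above (8/11) h/ξ; the constant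
is 4 · 11/8 = 11/2. -/
lemma sq_sub_le_of_le {c ξ μ x : ℝ} (hξ : 8 * c / 3 ≤ ξ) (hμ : 0 < μ) (hx : 0 < x)
    (hμc : μ ≤ c) (hxc : x ≤ c) :
    (x - μ) ^ 2 ≤ 11 * c / 2 * (ξ * (1 - Real.exp (-(ξ⁻¹ * (√x - √μ) ^ 2)))) := by
  have hc : 0 < c := by linarith
  have hξ0 : 0 < ξ := by linarith
  have hμ2 : √μ ^ 2 = μ := Real.sq_sqrt hμ.le
  have hx2 : √x ^ 2 = x := Real.sq_sqrt hx.le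
  have hμ0 : 0 ≤ √μ := Real.sqrt_nonneg _
  have hx0 : 0 ≤ √x := Real.sqrt_nonneg _
  have hm : √μ ≤ √c := Real.sqrt_le_sqrt hμc
  have hxx : √x ≤ √c := Real.sqrt_le_sqrt hxc
  have hc2 : √c ^ 2 = c := Real.sq_sqrt hc.le
  set h := (√x - √μ) ^ 2 with hh
  have h0 : 0 ≤ h := sq_nonneg _
  have hhc : h ≤ c := by
    rw [hh, ← hc2]
    exact sq_le_sq' (by linarith) (by linarith)
  have h1 : (x - μ) ^ 2 ≤ 4 * c * h := by
    have : (x - μ) ^ 2 = (√x + √μ) ^ 2 * h := by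
      nth_rewrite 1 [← hx2, ← hμ2]
      rw [hh]; ring
    rw [this]
    refine mul_le_mul_of_nonneg_right ?_ h0
    have : (√x + √μ) ^ 2 ≤ (2 * √c) ^ 2 := pow_le_pow_left₀ (by positivity) (by linarith) 2
    nlinarith
  have hu : ξ⁻¹ * h ≤ 3 / 8 := by
    rw [inv_mul_le_iff₀ hξ0]
    linarith
  have hu0 : 0 ≤ ξ⁻¹ * h := by positivity
  have h2 : Real.exp (-(ξ⁻¹ * h)) ≤ (1 + ξ⁻¹ * h)⁻¹ := by
    rw [Real.exp_neg]
    refine inv_anti₀ (by positivity) ?_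
    linarith [Real.add_one_le_exp (ξ⁻¹ * h)]
  -- For u ≤ 3/8, 1 - e^(-u) ≥ u/(1 + u) ≥ 8u/11.
  have h3 : 8 / 11 * (ξ⁻¹ * h) ≤ 1 - Real.exp (-(ξ⁻¹ * h)) := by
    have : (1 + ξ⁻¹ * h)⁻¹ ≤ 1 - 8 / 11 * (ξ⁻¹ * h) := by
      rw [inv_le_iff_one_le_mul₀ (by positivity)]
      nlinarith
    linarith
  have h4 : 8 / 11 * h ≤ ξ * (1 - Real.exp (-(ξ⁻¹ * h))) := by
    have := mul_le_mul_of_nonneg_left h3 hξ0.le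
    have e : ξ * (8 / 11 * (ξ⁻¹ * h)) = 8 / 11 * h := by field_simp
    linarith
  have := mul_le_mul_of_nonneg_left h4 (by positivity : 0 ≤ 11 * c / 2)
  linarith

end PenalizedLikelihood

/-! ### Rounding to the grids and Kraft's inequality -/

section Codebooks

variable {n₁ n₂ n₃ r : ℕ}

lemma tprod_apply {n₄ : ℕ} (A : Tensor n₁ n₂ n₃) (B : Tensor n₂ n₄ n₃) (p : Idx n₁ n₄ n₃) :
    tprod A B p = ∑ q : Fin n₃ × Fin n₂, A (p.1, q.2, p.2.2 - q.1) * B (q.2, p.2.1, q.1) :=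
  rfl

/-- Rounding goes up, so that products of nonnegative factors only grow and the lower bound ζ
survives; 0 stays 0, so the number of nonzero entries does not grow. -/
lemma exists_grid_ge {ϑ : ℕ} (hϑ : 2 ≤ ϑ) {w : ℝ} (hw : 0 < w) {a : ℝ} (ha : 0 ≤ a)
    (haw : a ≤ w) :
    ∃ y ∈ grid ϑ w, a ≤ y ∧ y ≤ a + w / (ϑ - 1) ∧ y ≤ w ∧ (a = 0 → y = 0) := by
  have h2 : (2 : ℝ) ≤ ϑ := by exact_mod_cast hϑ
  have hd : (0 : ℝ) < (ϑ : ℝ) - 1 := by linarith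
  have hn : 0 ≤ a / w * (ϑ - 1) := by positivity
  set k := ⌈a / w * ((ϑ : ℝ) - 1)⌉₊ with hk
  have h3 : a / w * (ϑ - 1) ≤ k := Nat.le_ceil _
  have h4 : (k : ℝ) < a / w * (ϑ - 1) + 1 := Nat.ceil_lt_add_one hn
  have h5 : k ≤ ϑ - 1 := by
    rw [hk, Nat.ceil_le]
    push_cast [Nat.cast_sub (by omega : 1 ≤ ϑ)]
    have : a / w ≤ 1 := by rw [div_le_one hw]; exact haw
    nlinarith
  have h5' : (k : ℝ) ≤ ϑ - 1 := by
    have : (k : ℝ) ≤ ((ϑ - 1 : ℕ) : ℝ) := by exact_mod_cast h5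
    push_cast [Nat.cast_sub (by omega : 1 ≤ ϑ)] at this
    exact this
  have e : w * (a / w * (ϑ - 1) / (ϑ - 1)) = a := by field_simp
  refine ⟨w * (k / ((ϑ : ℝ) - 1)), ⟨k, by omega, rfl⟩, ?_, ?_, ?_, ?_⟩
  · calc a = w * (a / w * (ϑ - 1) / (ϑ - 1)) := e.symm
      _ ≤ _ := by gcongr
  · calc w * (k / ((ϑ : ℝ) - 1)) ≤ w * ((a / w * (ϑ - 1) + 1) / (ϑ - 1)) := by gcongr
      _ = _ := by rw [add_div, mul_add, e]; ring
  · have : (k : ℝ) / (ϑ - 1) ≤ 1 := by rw [div_le_one hd]; exact h5'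
    nlinarith
  · rintro rfl
    simp [hk]

/-- Rounding up the factors to the grids increases the product by a small amount. -/
lemma exists_codebook_ge {ϑ : ℕ} (hϑ : 2 ≤ ϑ) {b : ℝ} (hb : 0 < b) {A : Tensor n₁ r n₃}
    {B : Tensor r n₂ n₃} (hA : ∀ p, 0 ≤ A p ∧ A p ≤ 1) (hB : ∀ p, 0 ≤ B p ∧ B p ≤ b) :
    ∃ A' ∈ codebookA n₁ r n₃ ϑ, ∃ B' ∈ codebookB r n₂ n₃ ϑ b, l0norm B' ≤ l0norm B ∧
      ∀ p, tprod A B p ≤ tprod A' B' p ∧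
        tprod A' B' p ≤ tprod A B p + n₃ * r * (2 * b / (ϑ - 1)) := by
  have h2 : (2 : ℝ) ≤ ϑ := by exact_mod_cast hϑ
  have hd : (0 : ℝ) < (ϑ : ℝ) - 1 := by linarith
  choose A' hA1 hA2 hA3 hA4 hA5 using fun p =>
    exists_grid_ge hϑ one_pos (hA p).1 (hA p).2
  choose B' hB1 hB2 hB3 hB4 hB5 using fun p => exists_grid_ge hϑ hb (hB p).1 (hB p).2
  refine ⟨A', hA1, B', fun p => Or.inr (hB1 p), ?_, fun p => ⟨?_, ?_⟩⟩
  · refine Finset.card_le_card fun p => ?_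
    simp only [Finset.mem_filter, Finset.mem_univ, true_and]
    exact mt (hB5 p)
  · rw [tprod_apply, tprod_apply]
    exact Finset.sum_le_sum fun q _ => mul_le_mul (hA2 _) (hB2 _) (hB _).1
      ((hA _).1.trans (hA2 _))
  · rw [tprod_apply, tprod_apply]
    have : (n₃ : ℝ) * r * (2 * b / (ϑ - 1)) =
        ∑ _q : Fin n₃ × Fin r, 2 * b / ((ϑ : ℝ) - 1) := by simp
    rw [this, ← Finset.sum_add_distrib]
    refine Finset.sum_le_sum fun q _ => ?_
    generalize (p.1, q.2, p.2.2 - q.1) = u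
    generalize (q.2, p.2.1, q.1) = v
    have hB0 : 0 ≤ B' v := (hB v).1.trans (hB2 v)
    -- Split A'B' - AB = (A' - A)B' + A(B' - B); each part is at most b/(ϑ - 1).
    have h3 : (A' u - A u) * B' v ≤ 1 / (ϑ - 1) * b :=
      mul_le_mul (by linarith [hA3 u]) (hB4 v) hB0 (by positivity)
    have h4 : A u * (B' v - B v) ≤ 1 * (b / (ϑ - 1)) :=
      mul_le_mul (hA u).2 (by linarith [hB3 v]) (by linarith [hB2 v]) zero_le_one
    have h5 : 2 * b / ((ϑ : ℝ) - 1) = 1 / (ϑ - 1) * b + 1 * (b / (ϑ - 1)) := by ring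
    rw [h5]
    linarith

open Classical in
/-- The levels `grid ϑ a` as a finite set. -/
noncomputable def gridFinset (ϑ : ℕ) (a : ℝ) : Finset ℝ :=
  (Finset.range ϑ).image fun k : ℕ => a * (k / ((ϑ : ℝ) - 1))

lemma mem_gridFinset {ϑ : ℕ} {a x : ℝ} : x ∈ gridFinset ϑ a ↔ x ∈ grid ϑ a := by
  simp [gridFinset, grid, eq_comm]

lemma card_gridFinset_le (ϑ : ℕ) (a : ℝ) : (gridFinset ϑ a).card ≤ ϑ :=
  Finset.card_image_le.trans (by simp)

lemma zero_mem_grid {ϑ : ℕ} (hϑ : 0 < ϑ) (a : ℝ) : (0 : ℝ) ∈ grid ϑ a := ⟨0, hϑ, by simp⟩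

/-- The pairs of discretized factors as a finite set. -/
noncomputable def codebookFinset (n₁ n₂ n₃ r ϑ : ℕ) (b : ℝ) :
    Finset (Tensor n₁ r n₃ × Tensor r n₂ n₃) :=
  (Fintype.piFinset fun _ => gridFinset ϑ 1) ×ˢ (Fintype.piFinset fun _ => gridFinset ϑ b)

lemma mem_codebookFinset {ϑ : ℕ} (hϑ : 0 < ϑ) {b : ℝ} {q : Tensor n₁ r n₃ × Tensor r n₂ n₃}
    (h1 : q.1 ∈ codebookA n₁ r n₃ ϑ) (h2 : q.2 ∈ codebookB r n₂ n₃ ϑ b) :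
    q ∈ codebookFinset n₁ n₂ n₃ r ϑ b := by
  simp only [codebookFinset, Finset.mem_product, Fintype.mem_piFinset, mem_gridFinset]
  refine ⟨h1, fun p => (h2 p).elim (fun h => ?_) id⟩
  rw [h]
  exact zero_mem_grid hϑ b

/-- Kraft's inequality for the penalty `τ (r n₁ n₃ + ‖B‖₀)`. -/
lemma sum_exp_neg_penalty_le_one {ϑ : ℕ} (b : ℝ) {τ : ℝ} (hn₁ : 1 ≤ n₁)
    (h1 : ϑ * Real.exp (-τ) ≤ Real.exp (-1)) (h2 : n₂ * (ϑ * Real.exp (-τ)) ≤ 1) :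
    ∑ q ∈ codebookFinset n₁ n₂ n₃ r ϑ b,
      Real.exp (-(τ * ((r : ℝ) * n₁ * n₃ + l0norm q.2))) ≤ 1 := by
  -- Weights that make the sum over `B` factor over entries: each contributes at most 1 + ϑ e^(-τ).
  let w : ℝ → ℝ := fun x => if x ≠ 0 then Real.exp (-τ) else 1
  have e1 : ∀ q : Tensor n₁ r n₃ × Tensor r n₂ n₃,
      Real.exp (-(τ * ((r : ℝ) * n₁ * n₃ + l0norm q.2))) =
      Real.exp (-τ) ^ (n₁ * (r * n₃)) * ∏ p, w (q.2 p) := by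
    intro q
    simp only [w]
    rw [Finset.prod_ite, Finset.prod_const_one, mul_one, Finset.prod_const, ← pow_add,
      ← Real.exp_nat_mul]
    unfold l0norm
    push_cast
    ring_nf
  simp_rw [e1, codebookFinset, Finset.sum_product, ← Finset.mul_sum]
  rw [Finset.sum_const, ← Finset.prod_univ_sum (fun _ : Idx r n₂ n₃ => gridFinset ϑ b)
    (fun _ x => w x)]
  have hx : 0 ≤ ϑ * Real.exp (-τ) := by positivity
  have h3 : ∑ x ∈ gridFinset ϑ b, w x ≤ Real.exp (ϑ * Real.exp (-τ)) := by
    calc ∑ x ∈ gridFinset ϑ b, w x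
        ≤ ∑ x ∈ gridFinset ϑ b, (Real.exp (-τ) + if x = 0 then 1 else 0) := by
          refine Finset.sum_le_sum fun x _ => ?_
          have := Real.exp_pos (-τ)
          simp only [w]
          split_ifs <;> simp_all
          linarith
      _ ≤ ϑ * Real.exp (-τ) + 1 := by
          rw [Finset.sum_add_distrib, Finset.sum_const, nsmul_eq_mul, Finset.sum_ite_eq']
          refine add_le_add (mul_le_mul_of_nonneg_right ?_ (Real.exp_pos _).le) ?_
          · exact_mod_cast card_gridFinset_le ϑ b
          · split_ifs <;> norm_num
      _ ≤ _ := Real.add_one_le_exp _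
  have h3' : 0 ≤ ∑ x ∈ gridFinset ϑ b, w x :=
    Finset.sum_nonneg fun x _ => by simp only [w]; split_ifs <;> positivity
  have h4 : (Fintype.piFinset fun _ : Idx n₁ r n₃ => gridFinset ϑ 1).card ≤
      ϑ ^ (n₁ * (r * n₃)) := by
    rw [Fintype.card_piFinset, Finset.prod_const, Finset.card_univ]
    simp only [Fintype.card_prod, Fintype.card_fin]
    exact Nat.pow_le_pow_left (card_gridFinset_le _ _) _
  rw [Finset.prod_const, nsmul_eq_mul, mul_left_comm]
  have h5 : (Finset.univ : Finset (Idx r n₂ n₃)).card = r * (n₂ * n₃) := by simp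
  rw [h5]
  calc _ ≤ ((ϑ : ℝ) ^ (n₁ * (r * n₃))) * (Real.exp (-τ) ^ (n₁ * (r * n₃)) *
        Real.exp (ϑ * Real.exp (-τ)) ^ (r * (n₂ * n₃))) := by
        gcongr
        exact_mod_cast h4
    _ = (ϑ * Real.exp (-τ)) ^ (n₁ * (r * n₃)) *
        Real.exp ((r * n₃) * (n₂ * (ϑ * Real.exp (-τ)))) := by
        rw [← mul_assoc, ← mul_pow, ← Real.exp_nat_mul]
        push_cast
        ring_nf
    _ ≤ Real.exp (-1) ^ (n₁ * (r * n₃)) * Real.exp ((r * n₃) * 1) := by gcongr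
    -- The excess e^(r n₃) from the second factors is absorbed by e^(-n₁ r n₃) from the first.
    _ ≤ 1 := by
        rw [← Real.exp_nat_mul, ← Real.exp_add, Real.exp_le_one_iff]
        push_cast
        have : (1 : ℝ) ≤ n₁ := by exact_mod_cast hn₁
        have h0 : (0 : ℝ) ≤ r * n₃ := by positivity
        nlinarith

end Codebooks

/-! ### Consequences of the choice of β and of the number of levels -/

section Parameters

lemma rpow_le_levels (n₁ n₂ : ℕ) (hM : 2 ≤ max n₁ n₂) (β : ℝ) :
    ((max n₁ n₂ : ℕ) : ℝ) ^ β ≤ levels n₁ n₂ β := by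
  have hM' : (0 : ℝ) < (max n₁ n₂ : ℕ) := by exact_mod_cast (by omega : 0 < max n₁ n₂)
  have e : ((max n₁ n₂ : ℕ) : ℝ) ^ β = 2 ^ (β * Real.logb 2 (max n₁ n₂ : ℕ)) := by
    rw [mul_comm, Real.rpow_mul two_pos.le,
      Real.rpow_logb two_pos (by norm_num) hM']
  rw [e, levels, Nat.cast_pow, ← Real.rpow_natCast, Nat.cast_ofNat]
  exact Real.rpow_le_rpow_of_exponent_le one_le_two (Nat.le_ceil _)

lemma levels_le_two_mul_rpow (n₁ n₂ : ℕ) (hM : 2 ≤ max n₁ n₂) {β : ℝ} (hβ : 0 ≤ β) :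
    (levels n₁ n₂ β : ℝ) ≤ 2 * ((max n₁ n₂ : ℕ) : ℝ) ^ β := by
  have hM1 : (1 : ℝ) ≤ (max n₁ n₂ : ℕ) := by exact_mod_cast (by omega : 1 ≤ max n₁ n₂)
  have hM' : (0 : ℝ) < (max n₁ n₂ : ℕ) := by linarith
  have e : 2 * ((max n₁ n₂ : ℕ) : ℝ) ^ β = 2 ^ (β * Real.logb 2 (max n₁ n₂ : ℕ) + 1) := by
    rw [Real.rpow_add two_pos, Real.rpow_one, mul_comm β, Real.rpow_mul two_pos.le,
      Real.rpow_logb two_pos (by norm_num) hM', mul_comm]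
  rw [e, levels, Nat.cast_pow, ← Real.rpow_natCast, Nat.cast_ofNat]
  refine Real.rpow_le_rpow_of_exponent_le one_le_two (Nat.ceil_lt_add_one ?_).le
  exact mul_nonneg hβ (Real.logb_nonneg one_lt_two hM1)

lemma le_rpow_betaParam (n₁ n₂ n₃ r : ℕ) (hM : 2 ≤ max n₁ n₂) (hr : 0 < r) (hn₃ : 0 < n₃)
    {b c : ℝ} (hb : 0 < b) (hc : 0 < c) :
    ((max n₁ n₂ : ℕ) : ℝ) * (3 * r * (n₃ : ℝ) ^ (3 / 2 : ℝ) * b / c) ≤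
      ((max n₁ n₂ : ℕ) : ℝ) ^ betaParam n₁ n₂ n₃ r b c := by
  have hM1 : (1 : ℝ) < (max n₁ n₂ : ℕ) := by exact_mod_cast (by omega : 1 < max n₁ n₂)
  have hM' : (0 : ℝ) < (max n₁ n₂ : ℕ) := by linarith
  have hlog : 0 < Real.log (max n₁ n₂ : ℕ) := Real.log_pos hM1
  have hr' : (0 : ℝ) < r := by exact_mod_cast hr
  have hn' : (0 : ℝ) < n₃ := by exact_mod_cast hn₃
  have hQ : 0 < 3 * r * (n₃ : ℝ) ^ (3 / 2 : ℝ) * b / c := by positivity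
  refine le_trans (le_of_eq ?_)
    (Real.rpow_le_rpow_of_exponent_le hM1.le (le_max_right _ _))
  rw [Real.rpow_add hM', Real.rpow_one, Real.rpow_def_of_pos hM',
    mul_div_cancel₀ _ hlog.ne', Real.exp_log hQ]

/-- With M = n₁ ∨ n₂, the left side is at most 2 M^β M^(-2β-4) ≤ M^(-β-3), using 2 ≤ M. -/
lemma levels_mul_exp_le (n₁ n₂ : ℕ) (hM : 2 ≤ max n₁ n₂) {β : ℝ} (hβ : 3 ≤ β) :
    levels n₁ n₂ β * Real.exp (-(2 * (β + 2) * Real.log (max n₁ n₂ : ℕ))) ≤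
      Real.exp (-(6 * Real.log (max n₁ n₂ : ℕ))) := by
  have hM2 : (2 : ℝ) ≤ (max n₁ n₂ : ℕ) := by exact_mod_cast hM
  have hM' : (0 : ℝ) < (max n₁ n₂ : ℕ) := by linarith
  have h2 : Real.log 2 ≤ Real.log (max n₁ n₂ : ℕ) := Real.log_le_log two_pos hM2
  have h0 : 0 < Real.log 2 := Real.log_pos one_lt_two
  calc _ ≤ 2 * ((max n₁ n₂ : ℕ) : ℝ) ^ β *
        Real.exp (-(2 * (β + 2) * Real.log (max n₁ n₂ : ℕ))) :=
        mul_le_mul_of_nonneg_right (levels_le_two_mul_rpow n₁ n₂ hM (by linarith))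
          (Real.exp_pos _).le
    _ = Real.exp (Real.log 2 + Real.log (max n₁ n₂ : ℕ) * β +
          -(2 * (β + 2) * Real.log (max n₁ n₂ : ℕ))) := by
        rw [Real.exp_add, Real.exp_add, Real.exp_log two_pos, Real.rpow_def_of_pos hM']
    _ ≤ _ := by
        rw [Real.exp_le_exp]
        nlinarith

/-- The quantization error is at most `c / √m`. -/
lemma quantization_error_le {n₁ n₂ n₃ r m : ℕ} (hM : 2 ≤ max n₁ n₂) (hr : 0 < r)
    (hn₃ : 0 < n₃) (hm : m ≤ n₁ * n₂ * n₃) {b c : ℝ} (hb : 0 < b) (hc : 0 < c) :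
    n₃ * r * (2 * b / ((levels n₁ n₂ (betaParam n₁ n₂ n₃ r b c) : ℝ) - 1)) * √m ≤ c := by
  set M := max n₁ n₂ with hMdef
  set β := betaParam n₁ n₂ n₃ r b c with hβ
  have hβ3 : 3 ≤ β := le_max_left _ _
  have hM2 : (2 : ℝ) ≤ (M : ℕ) := by exact_mod_cast hM
  have h8 : (8 : ℝ) ≤ levels n₁ n₂ β := by
    refine le_trans ?_ (rpow_le_levels n₁ n₂ hM β)
    calc (8 : ℝ) = 2 ^ (3 : ℝ) := by norm_num
      _ ≤ (M : ℝ) ^ (3 : ℝ) := by gcongr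
      _ ≤ _ := Real.rpow_le_rpow_of_exponent_le (by linarith) hβ3
  have hd : (0 : ℝ) < levels n₁ n₂ β - 1 := by linarith
  have hn' : (0 : ℝ) < n₃ := by exact_mod_cast hn₃
  have hr' : (0 : ℝ) < r := by exact_mod_cast hr
  -- From m ≤ n₁n₂n₃ ≤ M² n₃; the factor √n₃ accounts for the exponent 3/2 in β.
  have hs : √(m : ℝ) ≤ M * √n₃ := by
    rw [Real.sqrt_le_left (by positivity), mul_pow, Real.sq_sqrt hn'.le]
    have h1 : m ≤ M ^ 2 * n₃ := by
      refine hm.trans (Nat.mul_le_mul_right _ ?_)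
      rw [sq]
      exact Nat.mul_le_mul (le_max_left _ _) (le_max_right _ _)
    exact_mod_cast h1
  have hlev : (M : ℝ) * (3 * r * (n₃ : ℝ) ^ (3 / 2 : ℝ) * b / c) ≤ levels n₁ n₂ β :=
    (le_rpow_betaParam n₁ n₂ n₃ r hM hr hn₃ hb hc).trans (rpow_le_levels n₁ n₂ hM β)
  have e : (n₃ : ℝ) ^ (3 / 2 : ℝ) = n₃ * √n₃ := by
    rw [Real.sqrt_eq_rpow, show (3 / 2 : ℝ) = 1 + 1 / 2 by norm_num, Real.rpow_add hn',
      Real.rpow_one]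
  rw [e] at hlev
  have h3 : 3 * (n₃ * r * b * (M * √n₃)) ≤ c * levels n₁ n₂ β := by
    have := mul_le_mul_of_nonneg_left hlev hc.le
    have e2 : c * ((M : ℝ) * (3 * r * (n₃ * √n₃) * b / c)) =
        3 * (n₃ * r * b * (M * √n₃)) := by field_simp
    linarith
  have h4 : n₃ * r * b * √(m : ℝ) ≤ n₃ * r * b * (M * √n₃) := by gcongr
  have e3 : n₃ * r * (2 * b / ((levels n₁ n₂ β : ℝ) - 1)) * √(m : ℝ) =
      2 * (n₃ * r * b * √(m : ℝ)) / (levels n₁ n₂ β - 1) := by ring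
  rw [e3, div_le_iff₀ hd]
  -- The numerator is at most 2cϑ/3, and 2ϑ/3 ≤ ϑ - 1 because ϑ ≥ 8.
  nlinarith

end Parameters

/-! ### The oracle candidate and the final bound -/

open Classical in
lemma log_likelihood_sub {n₁ n₂ n₃ : ℕ} {μ x : Tensor n₁ n₂ n₃} (hμ : ∀ p, 0 < μ p)
    (hx : ∀ p, 0 < x p) (T : Set (Idx n₁ n₂ n₃)) (y : Idx n₁ n₂ n₃ → ℕ) :
    Real.log (likelihood x T y) - Real.log (likelihood μ T y) = sampledLogRatio μ x (T, y) := by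
  have key : ∀ {x : Tensor n₁ n₂ n₃}, (∀ p, 0 < x p) → Real.log (likelihood x T y) =
      ∑ p with p ∈ T, (y p * Real.log (x p) - x p - Real.log (y p)!) := by
    intro x hx
    rw [likelihood, Real.log_prod fun p _ => by have := hx p; positivity]
    refine Finset.sum_congr rfl fun p _ => ?_
    have := hx p
    rw [Real.log_div (by positivity) (by positivity), Real.log_mul (by positivity) (by positivity),
      Real.log_pow, Real.log_exp]
    ring
  rw [key hx, key hμ, ← Finset.sum_sub_distrib, Finset.sum_filter, sampledLogRatio]
  refine Finset.sum_congr rfl fun p _ => ?_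
  simp only [logRatio]
  rw [Real.log_div (hx p).ne' (hμ p).ne']
  split_ifs
  · ring
  · rfl

lemma frobNorm_sq {n₁ n₂ n₃ : ℕ} (X : Tensor n₁ n₂ n₃) : frobNorm X ^ 2 = ∑ p, X p ^ 2 :=
  Real.sq_sqrt (Finset.sum_nonneg fun _ _ => sq_nonneg _)

/-- A good candidate, obtained by rounding up the true factors. -/
lemma exists_candidate {n₁ n₂ n₃ r m : ℕ} (hM : 2 ≤ max n₁ n₂) (hr : 0 < r)
    (hn₃ : 0 < n₃) (hm4 : 4 ≤ m) (hm : m ≤ n₁ * n₂ * n₃) {b c ζ : ℝ} (hb : 0 < b) (hc : 0 < c)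
    (hζ : 0 < ζ) {A : Tensor n₁ r n₃} {B : Tensor r n₂ n₃} (hA : ∀ p, 0 ≤ A p ∧ A p ≤ 1)
    (hB : ∀ p, 0 ≤ B p ∧ B p ≤ b) (hXc : ∀ p, tprod A B p ≤ c / 2)
    (hXζ : ∀ p, ζ ≤ tprod A B p) :
    ∃ q ∈ candidates n₁ n₂ n₃ r (levels n₁ n₂ (betaParam n₁ n₂ n₃ r b c)) b c ζ,
      l0norm q.2 ≤ l0norm B ∧
      ∀ p, (tprod q.1 q.2 p - tprod A B p) ^ 2 / tprod q.1 q.2 p ≤ c ^ 2 / ζ / m := by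
  have h2 : 2 ≤ levels n₁ n₂ (betaParam n₁ n₂ n₃ r b c) := by
    have h1 := rpow_le_levels n₁ n₂ hM (betaParam n₁ n₂ n₃ r b c)
    have hM2 : (2 : ℝ) ≤ (max n₁ n₂ : ℕ) := by exact_mod_cast hM
    have h3 : ((max n₁ n₂ : ℕ) : ℝ) ≤ ((max n₁ n₂ : ℕ) : ℝ) ^ betaParam n₁ n₂ n₃ r b c := by
      refine Real.self_le_rpow_of_one_le (by linarith) ?_
      exact (by norm_num : (1 : ℝ) ≤ 3).trans (le_max_left _ _)
    exact_mod_cast hM2.trans (h3.trans h1)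
  have herr := quantization_error_le hM hr hn₃ hm hb hc
  obtain ⟨A', hA', B', hB', hl, hX⟩ := exists_codebook_ge h2 hb hA hB
  set δ := n₃ * r * (2 * b / ((levels n₁ n₂ (betaParam n₁ n₂ n₃ r b c) : ℝ) - 1)) with hδ
  have hm4' : (4 : ℝ) ≤ m := by exact_mod_cast hm4
  have hs2 : 2 ≤ √(m : ℝ) := by
    refine Real.le_sqrt_of_sq_le ?_
    linarith
  have hδ0 : 0 ≤ δ := by
    have : (2 : ℝ) ≤ levels n₁ n₂ (betaParam n₁ n₂ n₃ r b c) := by exact_mod_cast h2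
    have : (0 : ℝ) < levels n₁ n₂ (betaParam n₁ n₂ n₃ r b c) - 1 := by linarith
    positivity
  -- m ≥ 4 makes the rounding error at most c/2, the gap between the bound c/2 on the truth and the
  -- bound c on candidates.
  have hδc : δ ≤ c / 2 := by nlinarith
  have hδm : δ ^ 2 * m ≤ c ^ 2 := by
    have h1 := pow_le_pow_left₀ (by positivity) herr 2
    rwa [mul_pow, Real.sq_sqrt (by positivity)] at h1
  refine ⟨(A', B'), ⟨hA', hB', fun p => ⟨?_, ?_⟩, fun p => ?_⟩, hl, fun p => ?_⟩
  · linarith [hX p, hXζ p]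
  · linarith [hX p, hXc p]
  · linarith [hX p, hXζ p]
  · obtain ⟨hl, hu⟩ := hX p
    have hx : ζ ≤ tprod A' B' p := (hXζ p).trans hl
    have h1 : (tprod A' B' p - tprod A B p) ^ 2 ≤ δ ^ 2 :=
      pow_le_pow_left₀ (by linarith) (by linarith) 2
    calc (tprod A' B' p - tprod A B p) ^ 2 / tprod A' B' p ≤ δ ^ 2 / ζ := by gcongr
      _ ≤ (c ^ 2 / m) / ζ := by
        gcongr
        rw [le_div_iff₀ (by linarith)]
        exact hδm
      _ = _ := by ring

/-- Kraft's inequality for the penalties of the estimator. -/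
lemma kraft_levels {n₁ n₂ n₃ r : ℕ} (b : ℝ) {β : ℝ} (hn₁ : 2 ≤ n₁) (hβ : 3 ≤ β) :
    ∑ q ∈ codebookFinset n₁ n₂ n₃ r (levels n₁ n₂ β) b,
      Real.exp (-(2 * (β + 2) * Real.log (max n₁ n₂ : ℕ) *
        ((r : ℝ) * n₁ * n₃ + l0norm q.2))) ≤ 1 := by
  have hM : 2 ≤ max n₁ n₂ := hn₁.trans (le_max_left _ _)
  have hM2 : (2 : ℝ) ≤ (max n₁ n₂ : ℕ) := by exact_mod_cast hM
  have hx := levels_mul_exp_le n₁ n₂ hM hβ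
  have hlM2 : 0.69 ≤ Real.log (max n₁ n₂ : ℕ) := by
    have := Real.log_le_log two_pos hM2
    linarith [Real.log_two_gt_d9]
  refine sum_exp_neg_penalty_le_one b (by omega) (hx.trans ?_) ?_
  · rw [Real.exp_le_exp]
    linarith
  · have h2 : (n₂ : ℝ) ≤ Real.exp (Real.log (max n₁ n₂ : ℕ)) := by
      rw [Real.exp_log (by linarith)]
      exact_mod_cast le_max_right _ _
    refine (mul_le_mul h2 hx (by positivity) (Real.exp_pos _).le).trans ?_
    rw [← Real.exp_add, Real.exp_le_one_iff]
    linarith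

/-- Over m, the left side is 11cκ/2 + 22cW + (44/3)cκW, termwise below 12cκ + 48cW + 64cκW. -/
lemma risk_bound_le {c ζ W γ N l : ℝ} {m : ℕ} (hc : 0 < c) (hζ : 0 < ζ) (hm : 0 < (m : ℝ))
    (hW : 0 ≤ W) (hγ : 0 < γ) (hN : 0 < N) (hγN : γ * N = m) (hl : 0 ≤ l) :
    11 * c / 2 / γ * (c ^ 2 / ζ + (2 + 4 * (c ^ 2 / ζ) / 3) * (2 * W)) / N ≤
      4 * c ^ 3 * (3 + 8 * l) / (ζ * m) + 48 * c * (1 + 4 * c ^ 2 / (3 * ζ)) * W / m := by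
  have e1 : 4 * c ^ 3 * (3 + 8 * l) / (ζ * m) + 48 * c * (1 + 4 * c ^ 2 / (3 * ζ)) * W / m =
      (4 * c * (c ^ 2 / ζ) * (3 + 8 * l) + 48 * c * (1 + 4 * (c ^ 2 / ζ) / 3) * W) / m := by
    field_simp
  have hκ : 0 < c ^ 2 / ζ := by positivity
  rw [e1]
  generalize c ^ 2 / ζ = κ at *
  have e2 : 11 * c / 2 / γ * (κ + (2 + 4 * κ / 3) * (2 * W)) / N =
      11 * c / 2 * (κ + (2 + 4 * κ / 3) * (2 * W)) / m := by
    rw [← hγN]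
    field_simp
  rw [e2]
  refine div_le_div_of_nonneg_right ?_ hm.le
  have a1 : 0 ≤ c * κ := by positivity
  have a2 : 0 ≤ c * W := by positivity
  have a3 : 0 ≤ c * κ * W := by positivity
  have a4 : 0 ≤ c * κ * l := by positivity
  linarith

end SparseNTF

open SparseNTF

theorem proposition3
    -- sizes
    (n₁ n₂ n₃ r m : ℕ) (hn₁ : 2 ≤ n₁) (hn₂ : 2 ≤ n₂) (hn₃ : 2 ≤ n₃) (hr : r ≤ min n₁ n₂)
    (hm : 4 ≤ m) (hm' : m ≤ n₁ * n₂ * n₃)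
    -- the unknown tensor and its bounded nonnegative factorization
    (b c ζ : ℝ)
    (Xs : SparseNTF.Tensor n₁ n₂ n₃) (As : SparseNTF.Tensor n₁ r n₃)
    (Bs : SparseNTF.Tensor r n₂ n₃)
    (hXs : Xs = SparseNTF.tprod As Bs)
    (hAs : ∀ p, 0 ≤ As p ∧ As p ≤ 1) (hBs : ∀ p, 0 ≤ Bs p ∧ Bs p ≤ b)
    (hXc : ∀ p, Xs p ≤ c / 2)
    (hζ : 0 < ζ) (hXζ : ∀ p, ζ ≤ Xs p)
    -- the parameters of the estimator
    (β lam : ℝ) (hβ : β = SparseNTF.betaParam n₁ n₂ n₃ r b c)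
    (hlam : lam = SparseNTF.lambdaParam n₁ n₂ β (c ^ 2 / ζ))
    -- the data: Bernoulli sampling and independent Poisson observations
    {S : Type*} [MeasurableSpace S] (P : Measure S) [IsProbabilityMeasure P]
    (γ : unitInterval) (hγ : (γ : ℝ) = (m : ℝ) / ((n₁ : ℝ) * n₂ * n₃))
    (Ω : S → Set (SparseNTF.Idx n₁ n₂ n₃)) (Y : S → SparseNTF.Idx n₁ n₂ n₃ → ℕ)
    (hΩ : HasLaw Ω (setBernoulli Set.univ γ) P)
    (hY : HasLaw Y (Measure.pi fun p => poissonMeasure (Xs p).toNNReal) P)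
    (hΩY : IndepFun Ω Y P)
    -- the estimator, with ties broken in any way
    (Xt : S → SparseNTF.Tensor n₁ n₂ n₃) (hXt : AEMeasurable Xt P)
    (hmin : ∀ᵐ s ∂P, SparseNTF.IsEstimate
      (SparseNTF.candidates n₁ n₂ n₃ r (SparseNTF.levels n₁ n₂ β) b c ζ) lam (Ω s) (Y s) (Xt s)) :
    Integrable (fun s => SparseNTF.frobNorm (Xt s - Xs) ^ 2) P ∧
      (∫ s, SparseNTF.frobNorm (Xt s - Xs) ^ 2 ∂P) / ((n₁ : ℝ) * n₂ * n₃) ≤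
        4 * c ^ 3 * (3 + 8 * Real.log m) / (ζ * m) +
          48 * c * (1 + 4 * c ^ 2 / (3 * ζ)) *
            ((β + 2) * ((r : ℝ) * n₁ * n₃ + SparseNTF.l0norm Bs) *
              Real.log (max n₁ n₂ : ℕ)) / m := by
  classical
  have hM : 2 ≤ max n₁ n₂ := hn₁.trans (le_max_left _ _)
  have hXs0 : ∀ p, 0 < Xs p := fun p => hζ.trans_le (hXζ p)
  let p₀ : Idx n₁ n₂ n₃ := (⟨0, by omega⟩, ⟨0, by omega⟩, ⟨0, by omega⟩)
  have hcζ : 2 * ζ ≤ c := by linarith [hXc p₀, hXζ p₀]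
  have hc : 0 < c := by linarith
  -- A positive truth forces r and b to be positive.
  have hr0 : 0 < r := by
    by_contra h0
    obtain rfl : r = 0 := by omega
    have := hXs0 p₀
    rw [hXs, tprod_apply] at this
    simp at this
  have hb : 0 < b := by
    have h1 := hXs0 p₀
    rw [hXs, tprod_apply] at h1
    by_contra hb
    refine absurd h1 (not_lt.2 (Finset.sum_nonpos fun q _ => ?_))
    exact mul_nonpos_of_nonneg_of_nonpos (hAs _).1 ((hBs _).2.trans (not_lt.1 hb))
  have hβ3 : 3 ≤ β := by rw [hβ]; exact le_max_left _ _
  have hM2 : (2 : ℝ) ≤ (max n₁ n₂ : ℕ) := by exact_mod_cast hM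
  set lM := Real.log (max n₁ n₂ : ℕ) with hlM
  have hlM2 : 0.69 ≤ lM := by
    have := Real.log_le_log two_pos hM2
    linarith [Real.log_two_gt_d9]
  set κ := c ^ 2 / ζ with hκ
  -- From 2ζ ≤ c; it gives 8c/3 ≤ ξ, as the comparison with squared error requires.
  have hκc : 2 * c ≤ κ := by
    rw [hκ, le_div_iff₀ hζ]
    nlinarith
  set ξ := 2 + 4 * κ / 3 with hξ
  set τ := 2 * (β + 2) * lM with hτ
  have hτ0 : 0 ≤ τ := by
    have : 0 ≤ β + 2 := by linarith
    have : 0 ≤ lM := by linarith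
    positivity
  have hlamτ : lam = ξ * τ := by
    rw [hlam, lambdaParam, ← hlM, hξ, hτ]
    ring
  obtain ⟨q₀, hq₀, hq₀l, hq₀X⟩ := exists_candidate (m := m) hM hr0 (by omega) hm hm' hb hc hζ hAs
    hBs (fun p => hXs ▸ hXc p) (fun p => hXs ▸ hXζ p)
  rw [← hβ] at hq₀
  rw [← hXs] at hq₀X
  set ϑ := levels n₁ n₂ β with hϑ
  have hϑ0 : 0 < ϑ := pow_pos two_pos _
  let L : Tensor n₁ r n₃ × Tensor r n₂ n₃ → ℝ := fun q => τ * ((r : ℝ) * n₁ * n₃ + l0norm q.2)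
  let C := candidates n₁ n₂ n₃ r ϑ b c ζ
  let K := (codebookFinset n₁ n₂ n₃ r ϑ b).filter (· ∈ C)
  have hCK : ∀ q ∈ C, q ∈ K := fun q hq =>
    Finset.mem_filter.2 ⟨mem_codebookFinset hϑ0 hq.1 hq.2.1, hq⟩
  have hKC : ∀ q ∈ K, q ∈ C := fun q hq => (Finset.mem_filter.1 hq).2
  have hpos : ∀ q ∈ C, ∀ p, 0 < tprod q.1 q.2 p := fun q hq p => hζ.trans_le (hq.2.2.2 p)
  have hkraft : ∑ q ∈ K, Real.exp (-L q) ≤ 1 :=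
    (Finset.sum_le_sum_of_subset_of_nonneg (Finset.filter_subset _ _)
      fun _ _ _ => (Real.exp_pos _).le).trans (kraft_levels b hn₁ hβ3)
  obtain ⟨R, hRi, hRint, hR⟩ := penalized_likelihood_bound γ (ξ := ξ) (by linarith) hXs0 K
    (fun q => tprod q.1 q.2) (fun q hq => hpos q (hKC q hq)) L hkraft (hCK q₀ hq₀)
  have hlaw : HasLaw (fun s => (Ω s, Y s)) (samplingLaw γ Xs) P :=
    (indepFun_iff_hasLaw_prodMk_prod hΩ hY).1 hΩY
  have hRPi : Integrable (fun s => R (Ω s, Y s)) P := by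
    have := hRi
    rw [← hlaw.map_eq] at this
    exact this.comp_aemeasurable hlaw.aemeasurable
  have hRPint : ∫ s, R (Ω s, Y s) ∂P = ∫ z, R z ∂(samplingLaw γ Xs) :=
    hlaw.integral_comp hRi.aestronglyMeasurable
  have hn₁' : (0 : ℝ) < n₁ := by exact_mod_cast (by omega : 0 < n₁)
  have hn₂' : (0 : ℝ) < n₂ := by exact_mod_cast (by omega : 0 < n₂)
  have hn₃' : (0 : ℝ) < n₃ := by exact_mod_cast (by omega : 0 < n₃)
  have hm0 : (4 : ℝ) ≤ m := by exact_mod_cast hm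
  have hγ0 : (0 : ℝ) < γ := by rw [hγ]; positivity
  have hbound : ∀ᵐ s ∂P, frobNorm (Xt s - Xs) ^ 2 ≤ 11 * c / 2 / γ * R (Ω s, Y s) := by
    filter_upwards [hmin] with s hs
    obtain ⟨q, hq, hXq, hqmin⟩ := hs
    have h1 := hR (Ω s, Y s) q (hCK q hq) (by
      have h1 : objective lam (Ω s) (Y s) q ≤ objective lam (Ω s) (Y s) q₀ := hqmin hq₀
      rw [objective, objective, hlamτ] at h1
      -- Subtracting the log-likelihood of the truth from both sides turns the objectives into log
      -- ratios; `L` exceeds τ‖B‖₀ by a constant, which does not affect the comparison.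
      rw [← log_likelihood_sub hXs0 (hpos q hq), ← log_likelihood_sub hXs0 (hpos q₀ hq₀)]
      simp only [L]
      linarith)
    have h2 : frobNorm (Xt s - Xs) ^ 2 ≤ ∑ p, 11 * c / 2 *
        (ξ * (1 - Real.exp (-(ξ⁻¹ * (√(tprod q.1 q.2 p) - √(Xs p)) ^ 2)))) := by
      rw [frobNorm_sq, hXq]
      refine Finset.sum_le_sum fun p _ => sq_sub_le_of_le (by linarith) (hXs0 p) (hpos q hq p)
        (by linarith [hXc p]) (hq.2.2.1 p).2
    rw [← Finset.mul_sum] at h2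
    refine h2.trans ?_
    have h3 := mul_le_mul_of_nonneg_left h1 (by positivity : 0 ≤ 11 * c / 2 / γ)
    rwa [← mul_assoc, div_mul_cancel₀ _ hγ0.ne'] at h3
  have hint : Integrable (fun s => frobNorm (Xt s - Xs) ^ 2) P := by
    refine (hRPi.const_mul (11 * c / 2 / γ)).mono' ?_ ?_
    · have hF : Measurable fun X : Tensor n₁ n₂ n₃ => frobNorm (X - Xs) ^ 2 := by
        simp_rw [frobNorm_sq, Pi.sub_apply]
        fun_prop
      exact (hF.comp_aemeasurable hXt).aestronglyMeasurable
    · filter_upwards [hbound] with s hs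
      rwa [Real.norm_of_nonneg (sq_nonneg _)]
  refine ⟨hint, ?_⟩
  have hN : (0 : ℝ) < (n₁ : ℝ) * n₂ * n₃ := by positivity
  have hγN : (γ : ℝ) * ((n₁ : ℝ) * n₂ * n₃) = m := by rw [hγ]; field_simp
  have h1 : ∫ s, frobNorm (Xt s - Xs) ^ 2 ∂P ≤
      11 * c / 2 / γ * ∫ z, R z ∂(samplingLaw γ Xs) := by
    rw [← hRPint, ← integral_const_mul]
    exact integral_mono_ae hint (hRPi.const_mul _) hbound
  set W := (β + 2) * ((r : ℝ) * n₁ * n₃ + l0norm Bs) * lM with hW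
  have hW0 : 0 ≤ W := by
    have : 0 ≤ β + 2 := by linarith
    have : 0 ≤ lM := by linarith
    positivity
  have h2 : ∫ z, R z ∂(samplingLaw γ Xs) ≤ κ + ξ * (2 * W) := by
    refine hRint.trans (add_le_add ?_ (mul_le_mul_of_nonneg_left ?_ (by linarith)))
    · calc (γ : ℝ) * ∑ p, (tprod q₀.1 q₀.2 p - Xs p) ^ 2 / tprod q₀.1 q₀.2 p
          ≤ γ * ∑ _p : Idx n₁ n₂ n₃, κ / m :=
            mul_le_mul_of_nonneg_left (Finset.sum_le_sum fun p _ => hq₀X p) hγ0.le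
        _ = (γ * ((n₁ : ℝ) * n₂ * n₃)) * (κ / m) := by
            simp
            ring
        _ = κ := by
            rw [hγN]
            field_simp
    · have : (l0norm q₀.2 : ℝ) ≤ l0norm Bs := by exact_mod_cast hq₀l
      calc L q₀ ≤ τ * ((r : ℝ) * n₁ * n₃ + l0norm Bs) := by simp only [L]; gcongr
        _ = 2 * W := by rw [hW, hτ]; ring
  have hlogm : 0 ≤ Real.log m := Real.log_nonneg (by linarith)
  refine (div_le_div_of_nonneg_right
    (h1.trans (mul_le_mul_of_nonneg_left h2 (by positivity))) hN.le).trans ?_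
  exact risk_bound_le hc hζ (by linarith) hW0 hγ0 hN hγN hlogm
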